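/- Conventions. Manifolds are smooth ($C^\infty$), finite-dimensional, without boundary, Hausdorff and second countable. A Lie groupoid $G=(G_1\rightrightarrows G_0)$ has source $s$ and target $t$, which are submersions. It is étale if $s$ and $t$ are local diffeomorphisms, and proper if $(s,t):G_1\to G_0\times G_0$ is a proper map. An étale Lie groupoid is effective if any two arrows $g,g'$ with the same source $x$ and the same target, for which the germs at $x$ of $\phi_g=t|_U\circ(s|_U)^{-1}$ ($U$ a small neighbourhood of $g$) and of $\phi_{g'}$ coincide, are equal. The orbit space $G_0/G_1$ is the quotient of $G_0$ by the relation $x\sim y$ if there is $g\in G_1$ with $s(g)=x$ and $t(g)=y$; $\pi_G:G_0\to G_0/G_1$ is the quotient map. It carries the quotient differential structure $C^\infty(G_0/G_1)=\{f:G_0/G_1\to\mathbb{R}\mid f\circ\pi_G\in C^\infty(G_0)\}$. A map $F:X\to Y$ between sets with differential structures is smooth if $f\circ F\in C^\infty(X)$ for all $f\in C^\infty(Y)$, and a diffeomorphism if it is bijective and both $F$ and $F^{-1}$ are smooth. A bibundle $P:G\to H$ between Lie groupoids is a manifold $P$ with a smooth left action of $G$ with anchor $a_L:P\to G_0$ and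 a smooth right action of $H$ with anchor $a_R:P\to H_0$ such that the two actions commute, $a_R$ is $G$-invariant, and $a_L$ is a principal right $H$-bundle; the latter means that $a_L$ is an $H$-invariant surjective submersion and that $P\times_{H_0}H_1\to P\times_{G_0}P$, $(p,h)\mapsto(p,p\cdot h)$, is a diffeomorphism. The bibundle $P$ is a Morita equivalence (invertible) if in addition $a_R:P\to H_0$ is a principal left $G$-bundle, defined in the same way. An isomorphism of bibundles $P\to Q$ is a diffeomorphism that preserves both anchors and is equivariant for both actions. Statement. Let $G=(G_1\rightrightarrows G_0)$ and $H=(H_1\rightrightarrows H_0)$ be effective proper étale Lie groupoids and let $P:G\to H$ be a bibundle. Then there is a unique map $\bar P:G_0/G_1\to H_0/H_1$ with $$\bar P\circ\pi_G\circ a_L=\pi_H\circ a_R ,$$ and $\bar P$ is smooth for the quotient differential structures. If $P$ is a Morita equivalence, then $\bar P$ is a diffeomorphism. If $Q:G\to H$ is another bibundle that is isomorphic to $P$, then $\bar Q=\bar P$. -/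

import Mathlib

open scoped Manifold ContDiff Topology

universe u v u' v' w w' x

namespace OrbitMap

/-! ### Differential spaces -/

/-- The weakest topology on `X` for which every member of `F` is continuous. -/
abbrev functionalTopology {X : Type*} (F : Set (X → ℝ)) : TopologicalSpace X :=
  ⨅ f ∈ F, TopologicalSpace.induced f inferInstance

/-- A (Sikorski) differential structure on a set `X`. -/
structure DifferentialStructure (X : Type*) where
  /-- The family of functions. -/
  functions : Set (X → ℝ)
  smooth_compat : ∀ (k : ℕ), 0 < k → ∀ f : Fin k → X → ℝ, (∀ i, f i ∈ functions) →
    ∀ g : EuclideanSpace ℝ (Fin k) → ℝ, ContDiff ℝ ∞ g →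
      (fun x => g (WithLp.toLp 2 fun i => f i x)) ∈ functions
  locality : ∀ f : X → ℝ,
    (∀ x, ∃ U : Set X, IsOpen[functionalTopology functions] U ∧ x ∈ U ∧
      ∃ g ∈ functions, Set.EqOn f g U) → f ∈ functions

/-- Functionally smooth maps: pullback takes the functions of `Y` to functions of `X`. -/
def IsSmoothMap {X Y : Type*} (FX : DifferentialStructure X) (FY : DifferentialStructure Y)
    (φ : X → Y) : Prop :=
  ∀ f ∈ FY.functions, f ∘ φ ∈ FX.functions

/-- Functional diffeomorphisms: smooth bijections whose inverse is smooth. -/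
def IsDiffeomorphism {X Y : Type*} (FX : DifferentialStructure X)
    (FY : DifferentialStructure Y) (φ : X → Y) : Prop :=
  ∃ e : X ≃ Y, ⇑e = φ ∧ IsSmoothMap FX FY e ∧ IsSmoothMap FY FX e.symm

/-- The quotient differential structure: the functions whose pullback along the quotient map
belongs to the given structure. -/
def DifferentialStructure.quotient {X : Type*} (F : DifferentialStructure X) (r : Setoid X) :
    DifferentialStructure (Quotient r) where
  functions := {f | f ∘ Quotient.mk r ∈ F.functions}
  smooth_compat k hk f hf g hg := F.smooth_compat k hk (fun i => f i ∘ Quotient.mk r) hf g hg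
  locality f hf := by
    refine F.locality _ fun x => ?_
    obtain ⟨U, hU, hxU, g, hg, hfg⟩ := hf (Quotient.mk r x)
    refine ⟨Quotient.mk r ⁻¹' U, ?_, hxU, g ∘ Quotient.mk r, hg, fun y hy => hfg hy⟩
    have hc : @Continuous _ _ (functionalTopology F.functions)
        (functionalTopology {f | f ∘ Quotient.mk r ∈ F.functions}) (Quotient.mk r) := by
      refine continuous_iInf_rng.2 fun f => continuous_iInf_rng.2 fun hf => ?_
      refine continuous_induced_rng.2 ?_
      exact continuous_iInf_dom (i := f ∘ Quotient.mk r)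
        (continuous_iInf_dom (i := hf) continuous_induced_dom)
    exact continuous_def.1 hc U hU

/-! ### Manifolds -/

/-- Smooth manifolds: Hausdorff, second countable, without boundary, of some dimension `dim`. -/
structure SmoothMfd where
  carrier : Type u
  dim : ℕ
  [top : TopologicalSpace carrier]
  [charted : ChartedSpace (EuclideanSpace ℝ (Fin dim)) carrier]
  [manifold : IsManifold (𝓡 dim) ∞ carrier]
  [t2 : T2Space carrier]
  [secondCountable : SecondCountableTopology carrier]

instance : CoeSort SmoothMfd.{u} (Type u) := ⟨SmoothMfd.carrier⟩

attribute [instance] SmoothMfd.top SmoothMfd.charted SmoothMfd.manifold SmoothMfd.t2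
  SmoothMfd.secondCountable

/-- The model with corners of a manifold. -/
noncomputable abbrev SmoothMfd.model (M : SmoothMfd.{u}) :
    ModelWithCorners ℝ (EuclideanSpace ℝ (Fin M.dim)) (EuclideanSpace ℝ (Fin M.dim)) :=
  𝓡 M.dim

/-- The differential structure of a manifold: its smooth real-valued functions. -/
def SmoothMfd.smoothFunctions (M : SmoothMfd.{u}) : DifferentialStructure M where
  functions := {f | ContMDiff M.model 𝓘(ℝ, ℝ) ∞ f}
  smooth_compat k _ f hf g hg := by
    refine hg.contMDiff.comp (I' := 𝓘(ℝ, EuclideanSpace ℝ (Fin k))) ?_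
    have h : ContMDiff M.model 𝓘(ℝ, Fin k → ℝ) ∞ fun x i => f i x :=
      contMDiff_pi_space.2 hf
    exact ((EuclideanSpace.equiv (Fin k) ℝ).symm.contDiff.contMDiff).comp h
  locality f hf := by
    intro x
    obtain ⟨U, hU, hxU, g, hg, hfg⟩ := hf x
    have hle : M.top ≤ functionalTopology {f : M → ℝ | ContMDiff M.model 𝓘(ℝ, ℝ) ∞ f} :=
      le_iInf fun f => le_iInf fun hf => continuous_iff_le_induced.1 hf.continuous
    exact (hg x).congr_of_eventuallyEq
      (Filter.eventuallyEq_of_mem ((hle U hU).mem_nhds hxU) hfg)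

/-- `f` restricts to a diffeomorphism from `S ⊆ M` onto `T ⊆ N`. It is used where `S` and `T` are
embedded submanifolds (fibre products along submersions); there smoothness on the set is
smoothness for the submanifold structure. -/
def IsDiffeoBetween {E E' H H' M N : Type*}
    [NormedAddCommGroup E] [NormedSpace ℝ E] [NormedAddCommGroup E'] [NormedSpace ℝ E']
    [TopologicalSpace H] [TopologicalSpace H'] (I : ModelWithCorners ℝ E H)
    (J : ModelWithCorners ℝ E' H') [TopologicalSpace M] [ChartedSpace H M]
    [TopologicalSpace N] [ChartedSpace H' N] (f : M → N) (S : Set M) (T : Set N) : Prop :=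
  ContMDiffOn I J ∞ f S ∧ Set.MapsTo f S T ∧
    ∃ g : N → M, ContMDiffOn J I ∞ g T ∧ Set.MapsTo g T S ∧ Set.InvOn g f S T

/-! ### Lie groupoids -/

/-- Lie groupoids. The product `mul g h` ("first `h`, then `g`") is meaningful only if
`src g = tgt h`; every condition on it, smoothness included, is restricted to such pairs, and its
other values are irrelevant. -/
structure LieGroupoid where
  Obj : SmoothMfd.{u}
  Arr : SmoothMfd.{v}
  src : Arr → Obj
  tgt : Arr → Obj
  unit : Obj → Arr
  inv : Arr → Arr
  mul : Arr → Arr → Arr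
  submersion_src : Manifold.IsSubmersion Arr.model Obj.model ∞ src
  submersion_tgt : Manifold.IsSubmersion Arr.model Obj.model ∞ tgt
  smooth_unit : ContMDiff Obj.model Arr.model ∞ unit
  smooth_inv : ContMDiff Arr.model Arr.model ∞ inv
  smooth_mul : ContMDiffOn (Arr.model.prod Arr.model) Arr.model ∞
    (fun q : Arr × Arr => mul q.1 q.2) {q | src q.1 = tgt q.2}
  src_unit : ∀ x, src (unit x) = x
  tgt_unit : ∀ x, tgt (unit x) = x
  src_inv : ∀ g, src (inv g) = tgt g
  tgt_inv : ∀ g, tgt (inv g) = src g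
  src_mul : ∀ g h, src g = tgt h → src (mul g h) = src h
  tgt_mul : ∀ g h, src g = tgt h → tgt (mul g h) = tgt g
  mul_assoc : ∀ g h k, src g = tgt h → src h = tgt k → mul (mul g h) k = mul g (mul h k)
  unit_mul : ∀ g, mul (unit (tgt g)) g = g
  mul_unit : ∀ g, mul g (unit (src g)) = g
  inv_mul : ∀ g, mul (inv g) g = unit (src g)
  mul_inv : ∀ g, mul g (inv g) = unit (tgt g)

namespace LieGroupoid

/-- Étale: source and target are local diffeomorphisms. -/
structure IsEtale (G : LieGroupoid.{u, v}) : Prop where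
  src : IsLocalDiffeomorph G.Arr.model G.Obj.model ∞ G.src
  tgt : IsLocalDiffeomorph G.Arr.model G.Obj.model ∞ G.tgt

/-- The local diffeomorphism `φ_g = t ∘ (s|_U)⁻¹` for a small neighbourhood `U` of `g`. Only its
germ at `src g` is meaningful (and independent of `U`). -/
noncomputable def IsEtale.localMap {G : LieGroupoid.{u, v}} (hG : G.IsEtale) (g : G.Arr) :
    G.Obj → G.Obj :=
  fun x => G.tgt ((hG.src g).localInverse x)

/-- Effective: the functor to the groupoid of germs, sending `g` to the germ of `φ_g` at `src g`,
is faithful. -/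
def IsEtale.IsEffective {G : LieGroupoid.{u, v}} (hG : G.IsEtale) : Prop :=
  ∀ g g' : G.Arr, G.src g = G.src g' → G.tgt g = G.tgt g' →
    hG.localMap g =ᶠ[𝓝 (G.src g)] hG.localMap g' → g = g'

/-- Proper: the map `(s, t)` is proper. -/
def IsProper (G : LieGroupoid.{u, v}) : Prop :=
  IsProperMap fun g : G.Arr => (G.src g, G.tgt g)

/-- Effective proper étale Lie groupoids. -/
structure IsEffectiveProperEtale (G : LieGroupoid.{u, v}) : Prop where
  etale : G.IsEtale
  effective : etale.IsEffective
  proper : G.IsProper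

/-- Two objects are equivalent if there is an arrow from one to the other. -/
def orbitRel (G : LieGroupoid.{u, v}) : Setoid G.Obj where
  r x y := ∃ g : G.Arr, G.src g = x ∧ G.tgt g = y
  iseqv :=
    { refl := fun x => ⟨G.unit x, G.src_unit x, G.tgt_unit x⟩
      symm := by
        rintro x y ⟨g, rfl, rfl⟩
        exact ⟨G.inv g, G.src_inv g, G.tgt_inv g⟩
      trans := by
        rintro x y z ⟨g, rfl, rfl⟩ ⟨h, hh, rfl⟩
        exact ⟨G.mul h g, G.src_mul h g hh, G.tgt_mul h g hh⟩ }

/-- The orbit space `G₀ / G₁`. -/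
def OrbitSpace (G : LieGroupoid.{u, v}) : Type u := Quotient G.orbitRel

/-- The quotient map `π_G : G₀ → G₀ / G₁`. -/
def proj (G : LieGroupoid.{u, v}) (x : G.Obj) : G.OrbitSpace := Quotient.mk G.orbitRel x

/-- The quotient differential structure on the orbit space. -/
def orbitStructure (G : LieGroupoid.{u, v}) : DifferentialStructure G.OrbitSpace :=
  G.Obj.smoothFunctions.quotient G.orbitRel

end LieGroupoid

/-! ### Actions and bibundles -/

/-- Smooth left actions of a Lie groupoid. Here `act g p` is meaningful only if
`src g = anchor p`. -/
structure LeftAction (G : LieGroupoid.{u, v}) (P : SmoothMfd.{w}) where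
  anchor : P → G.Obj
  act : G.Arr → P → P
  smooth_anchor : ContMDiff P.model G.Obj.model ∞ anchor
  smooth_act : ContMDiffOn (G.Arr.model.prod P.model) P.model ∞
    (fun q : G.Arr × P => act q.1 q.2) {q | G.src q.1 = anchor q.2}
  anchor_act : ∀ g p, G.src g = anchor p → anchor (act g p) = G.tgt g
  unit_act : ∀ p, act (G.unit (anchor p)) p = p
  mul_act : ∀ g h p, G.src g = G.tgt h → G.src h = anchor p →
    act (G.mul g h) p = act g (act h p)

/-- Smooth right actions of a Lie groupoid. Here `act p h` is meaningful only if
`anchor p = tgt h`. -/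
structure RightAction (H : LieGroupoid.{u', v'}) (P : SmoothMfd.{w}) where
  anchor : P → H.Obj
  act : P → H.Arr → P
  smooth_anchor : ContMDiff P.model H.Obj.model ∞ anchor
  smooth_act : ContMDiffOn (P.model.prod H.Arr.model) P.model ∞
    (fun q : P × H.Arr => act q.1 q.2) {q | anchor q.1 = H.tgt q.2}
  anchor_act : ∀ p h, anchor p = H.tgt h → anchor (act p h) = H.src h
  act_unit : ∀ p, act p (H.unit (anchor p)) = p
  act_mul : ∀ p h k, anchor p = H.tgt h → H.src h = H.tgt k →
    act p (H.mul h k) = act (act p h) k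

/-- `π : P → B` is a principal right `H`-bundle: an `H`-invariant surjective submersion for which
`P ×_{H₀} H₁ → P ×_B P`, `(p, h) ↦ (p, p · h)`, is a diffeomorphism. -/
structure RightAction.IsPrincipal {H : LieGroupoid.{u', v'}} {P : SmoothMfd.{w}} (A : RightAction H P)
    {B : SmoothMfd.{x}} (π : P → B) : Prop where
  surjective : Function.Surjective π
  submersion : Manifold.IsSubmersion P.model B.model ∞ π
  invariant : ∀ p h, A.anchor p = H.tgt h → π (A.act p h) = π p
  diffeo : IsDiffeoBetween (P.model.prod H.Arr.model) (P.model.prod P.model)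
    (fun q : P × H.Arr => (q.1, A.act q.1 q.2))
    {q | A.anchor q.1 = H.tgt q.2} {q : P × P | π q.1 = π q.2}

/-- `π : P → B` is a principal left `G`-bundle: a `G`-invariant surjective submersion for which
`G₁ ×_{G₀} P → P ×_B P`, `(g, p) ↦ (g · p, p)`, is a diffeomorphism. -/
structure LeftAction.IsPrincipal {G : LieGroupoid.{u, v}} {P : SmoothMfd.{w}} (A : LeftAction G P)
    {B : SmoothMfd.{x}} (π : P → B) : Prop where
  surjective : Function.Surjective π
  submersion : Manifold.IsSubmersion P.model B.model ∞ π
  invariant : ∀ g p, G.src g = A.anchor p → π (A.act g p) = π p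
  diffeo : IsDiffeoBetween (G.Arr.model.prod P.model) (P.model.prod P.model)
    (fun q : G.Arr × P => (A.act q.1 q.2, q.2))
    {q | G.src q.1 = A.anchor q.2} {q : P × P | π q.1 = π q.2}

/-- Bibundles `P : G → H`. -/
structure Bibundle (G : LieGroupoid.{u, v}) (H : LieGroupoid.{u', v'}) where
  total : SmoothMfd.{w}
  left : LeftAction G total
  right : RightAction H total
  actions_commute : ∀ g p h, G.src g = left.anchor p → right.anchor p = H.tgt h →
    right.act (left.act g p) h = left.act g (right.act p h)
  principal : right.IsPrincipal left.anchor
  invariant : ∀ g p, G.src g = left.anchor p → right.anchor (left.act g p) = right.anchor p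

namespace Bibundle

/-- A bibundle is invertible (a Morita equivalence) if its right anchor is a principal left
`G`-bundle. -/
def IsInvertible {G : LieGroupoid.{u, v}} {H : LieGroupoid.{u', v'}} (P : Bibundle.{u, v, u', v', w} G H) : Prop :=
  P.left.IsPrincipal P.right.anchor

/-- Isomorphisms of bibundles: equivariant diffeomorphisms. That both anchors are preserved is
part of equivariance, as it makes the actions on `α p` defined exactly when those on `p` are. -/
structure Iso {G : LieGroupoid.{u, v}} {H : LieGroupoid.{u', v'}} 
    (P : Bibundle.{u, v, u', v', w} G H) (Q : Bibundle.{u, v, u', v', w'} G H) where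
  toDiffeo : Diffeomorph P.total.model Q.total.model P.total Q.total ∞
  left_anchor : ∀ p, Q.left.anchor (toDiffeo p) = P.left.anchor p
  right_anchor : ∀ p, Q.right.anchor (toDiffeo p) = P.right.anchor p
  map_left : ∀ g p, G.src g = P.left.anchor p →
    toDiffeo (P.left.act g p) = Q.left.act g (toDiffeo p)
  map_right : ∀ p h, P.right.anchor p = H.tgt h →
    toDiffeo (P.right.act p h) = Q.right.act (toDiffeo p) h

/-- `φ` makes the diagram with the anchors and the quotient maps commute:
`φ ∘ π_G ∘ a_L = π_H ∘ a_R`. -/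
def DescendsTo {G : LieGroupoid.{u, v}} {H : LieGroupoid.{u', v'}} (P : Bibundle.{u, v, u', v', w} G H) (φ : G.OrbitSpace → H.OrbitSpace) : Prop :=
  ∀ p : P.total, φ (G.proj (P.left.anchor p)) = H.proj (P.right.anchor p)

end Bibundle

end OrbitMap

open Manifold Set

/-! The orbit map lifts a point of `G₀` along the left anchor to `P` and pushes it down along the
right anchor. Two lifts over the same `G`-orbit differ by the action of an arrow of `G`, which fixes
the right anchor, followed by that of an arrow of `H`, which moves the right anchor within its
`H`-orbit; the second arrow exists because `H` acts transitively on the fibres of the left anchor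
(`orbitRel_right_anchor`). Smoothness needs no global section: pulled back to `P`, a function `f ∘ φ
∘ π_G` becomes `f ∘ π_H ∘ a_R`, and smoothness descends along a submersion. For a Morita equivalence
the span can be read backwards, and the resulting map is the inverse. Uniqueness holds because `π_G
∘ a_L` is surjective. -/

/-- A submersion has smooth local sections, so smoothness descends along it: if `f ∘ π` is smooth
at `p` and `π` is a submersion at `p`, then `f` is smooth at `π p`. -/
theorem Manifold.IsSubmersionAt.contMDiffAt_of_comp {𝕜 E E' E'' H H' H'' M N Q : Type*}
    [NontriviallyNormedField 𝕜] [NormedAddCommGroup E] [NormedSpace 𝕜 E]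
    [NormedAddCommGroup E'] [NormedSpace 𝕜 E'] [NormedAddCommGroup E''] [NormedSpace 𝕜 E'']
    [TopologicalSpace H] [TopologicalSpace H'] [TopologicalSpace H'']
    {I : ModelWithCorners 𝕜 E H} {J : ModelWithCorners 𝕜 E' H'} {K : ModelWithCorners 𝕜 E'' H''}
    [TopologicalSpace M] [ChartedSpace H M] [TopologicalSpace N] [ChartedSpace H' N]
    [TopologicalSpace Q] [ChartedSpace H'' Q] [I.Boundaryless]
    {π : M → N} {f : N → Q} {p : M} (hπ : IsSubmersionAt I J ∞ π p)
    (hf : ContMDiffAt I K ∞ (f ∘ π) p) : ContMDiffAt J K ∞ f (π p) := by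
  set φ := hπ.domChart.extend I with hφ
  set ψ := hπ.codChart.extend J with hψ
  set e := hπ.equiv
  have hpφ : p ∈ φ.source := by
    rw [hφ, OpenPartialHomeomorph.extend_source]; exact hπ.mem_domChart_source
  have hpt : φ p ∈ φ.target := φ.map_source hpφ
  -- Openness of the target in the model space, from `I` being boundaryless, makes `φ.symm` smooth
  -- at `φ p` and keeps `τ y` in the target for `y` near `π p`.
  have hopen : IsOpen φ.target := hπ.domChart.isOpen_extend_target
  have hψπ : ∀ q ∈ φ.target, ψ (π (φ.symm q)) = (e q).1 := fun q hq => hπ.writtenInCharts hq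
  -- In the charts `π` is a projection from a product. The section `φ.symm ∘ τ` lifts the first
  -- coordinate and freezes the second at its value at `p`, so it passes through `p`.
  let τ : N → E := fun y => e.symm (ψ y, (e (φ p)).2)
  have hτp : τ (π p) = φ p := by
    have h := hψπ _ hpt
    rw [φ.left_inv hpφ] at h
    simp only [τ]
    rw [h, Prod.mk.eta, e.symm_apply_apply]
  have hτ : ContMDiffAt J 𝓘(𝕜, E) ∞ τ (π p) :=
    e.symm.contDiff.contMDiff.contMDiffAt.comp _
      ((OpenPartialHomeomorph.contMDiffAt_extend hπ.codChart_mem_maximalAtlas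
        hπ.mem_codChart_source).prodMk_space contMDiffAt_const)
  have hσ : ContMDiffAt J I ∞ (φ.symm ∘ τ) (π p) := by
    refine ContMDiffAt.comp (I' := 𝓘(𝕜, E)) _ ?_ hτ
    rw [hτp]
    exact (contMDiffOn_extend_symm hπ.domChart_mem_maximalAtlas).contMDiffAt
      (by rw [← OpenPartialHomeomorph.extend_target']; exact hopen.mem_nhds hpt)
  have hσp : (φ.symm ∘ τ) (π p) = p := by
    rw [Function.comp_apply, hτp, φ.left_inv hpφ]
  have hsec : ∀ᶠ y in 𝓝 (π p), π (φ.symm (τ y)) = y := by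
    have h₁ : ∀ᶠ y in 𝓝 (π p), τ y ∈ φ.target :=
      hτ.continuousAt.eventually (by rw [hτp]; exact hopen.mem_nhds hpt)
    have h₂ : ∀ᶠ y in 𝓝 (π p), y ∈ hπ.codChart.source :=
      hπ.codChart.open_source.mem_nhds hπ.mem_codChart_source
    filter_upwards [h₁, h₂] with y hy hyψ
    -- The chart `ψ` only separates points of its source, so both points must first be shown to lie
    -- there.
    refine ψ.injOn ?_ ?_ ?_
    · rw [hψ, OpenPartialHomeomorph.extend_source]
      refine hπ.source_subset_preimage_source ?_
      rw [← hπ.domChart.extend_source (I := I)]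
      exact φ.map_target hy
    · rwa [hψ, OpenPartialHomeomorph.extend_source]
    · rw [hψπ _ hy]
      simp [τ]
  have hcomp : ContMDiffAt J K ∞ ((f ∘ π) ∘ (φ.symm ∘ τ)) (π p) :=
    ContMDiffAt.comp (I' := I) _ (by rwa [hσp]) hσ
  refine hcomp.congr_of_eventuallyEq ?_
  filter_upwards [hsec] with y hy
  simp only [Function.comp_apply, hy]

namespace OrbitMap

/-- A span `M ← P → N` of a surjective submersion and a smooth map that is compatible with
equivalence relations on `M` and `N` induces a smooth map between the quotients. -/
theorem exists_isSmoothMap_quotient {P : SmoothMfd.{w}} {M : SmoothMfd.{u}} {N : SmoothMfd.{v}}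
    {a : P → M} {b : P → N} (r : Setoid M) (s : Setoid N) (hsurj : Function.Surjective a)
    (ha : IsSubmersion P.model M.model ∞ a) (hb : ContMDiff P.model N.model ∞ b)
    (hab : ∀ p q, r (a p) (a q) → s (b p) (b q)) :
    ∃ φ : Quotient r → Quotient s,
      IsSmoothMap (M.smoothFunctions.quotient r) (N.smoothFunctions.quotient s) φ ∧
        ∀ p, φ (Quotient.mk r (a p)) = Quotient.mk s (b p) := by
  -- An arbitrary choice of lifts suffices: `σ` need not even be continuous, since by `hab` the
  -- class of `b (σ x)` does not depend on it.
  let σ : M → P := Function.surjInv hsurj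
  have hσ : ∀ x, a (σ x) = x := Function.surjInv_eq hsurj
  let φ : Quotient r → Quotient s := Quotient.lift (fun x => Quotient.mk s (b (σ x)))
    fun x y hxy => Quotient.sound (hab _ _ (by rw [hσ, hσ]; exact hxy))
  have hφ : ∀ p, φ (Quotient.mk r (a p)) = Quotient.mk s (b p) := fun p =>
    Quotient.sound (hab _ _ (by rw [hσ]))
  refine ⟨φ, fun f hf x => ?_, hφ⟩
  obtain ⟨p, rfl⟩ := hsurj x
  refine (ha.isSubmersionAt p).contMDiffAt_of_comp ?_
  have hfb : ContMDiff P.model 𝓘(ℝ, ℝ) ∞ ((f ∘ Quotient.mk s) ∘ b) :=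
    ContMDiff.comp (I' := N.model) hf hb
  have heq : ((f ∘ φ) ∘ Quotient.mk r) ∘ a = (f ∘ Quotient.mk s) ∘ b :=
    funext fun q => congrArg f (hφ q)
  rw [heq]
  exact hfb p

namespace Bibundle

variable {G : LieGroupoid.{u, v}} {H : LieGroupoid.{u', v'}} (P : Bibundle.{u, v, u', v', w} G H)

/-- The right anchors of two points are equivalent if their left anchors are. -/
theorem orbitRel_right_anchor {p q : P.total}
    (h : G.orbitRel (P.left.anchor p) (P.left.anchor q)) :
    H.orbitRel (P.right.anchor p) (P.right.anchor q) := by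
  obtain ⟨g, hgs, hgt⟩ := h
  obtain ⟨-, -, k, -, hk, hinv⟩ := P.principal.diffeo
  -- Both `g · p` and `q` lie over the target of `g`, so principality yields an arrow `h` with `(g ·
  -- p) · h = q`.
  have hmem : ((P.left.act g p, q) : P.total × P.total) ∈
      {q : P.total × P.total | P.left.anchor q.1 = P.left.anchor q.2} := by
    simpa only [mem_ofPred_eq, P.left.anchor_act g p hgs] using hgt
  have hact := hinv.2 hmem
  have hdom := hk hmem
  obtain ⟨h₁, h₂⟩ := Prod.ext_iff.1 hact
  simp only [mem_ofPred_eq] at hdom h₁ h₂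
  -- A right action moves the anchor from the target of `h` to its source, so the arrow runs from
  -- the anchor of `q` to that of `p`.
  refine H.orbitRel.symm ⟨(k (P.left.act g p, q)).2, ?_, ?_⟩
  · rw [← P.right.anchor_act _ _ hdom, h₂]
  · rw [← hdom, h₁, P.invariant g p hgs]

/-- For a Morita equivalence, the left anchors of two points are equivalent if their right anchors
are. -/
theorem IsInvertible.orbitRel_left_anchor {P : Bibundle.{u, v, u', v', w} G H}
    (hP : P.IsInvertible) {p q : P.total}
    (h : H.orbitRel (P.right.anchor p) (P.right.anchor q)) :
    G.orbitRel (P.left.anchor p) (P.left.anchor q) := by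
  obtain ⟨h, hhs, hht⟩ := H.orbitRel.symm h
  obtain ⟨-, -, k, -, hk, hinv⟩ := hP.diffeo
  -- Here `p · h` and `q` share a right anchor, so some `g` satisfies `g · (p · h) = q`, while `p ·
  -- h` has the left anchor of `p`.
  have hmem : ((q, P.right.act p h) : P.total × P.total) ∈
      {q : P.total × P.total | P.right.anchor q.1 = P.right.anchor q.2} := by
    simpa only [mem_ofPred_eq, P.right.anchor_act p h hht.symm] using hhs.symm
  have hact := hinv.2 hmem
  have hdom := hk hmem
  obtain ⟨h₁, h₂⟩ := Prod.ext_iff.1 hact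
  simp only [mem_ofPred_eq] at hdom h₁ h₂
  refine ⟨(k (q, P.right.act p h)).1, ?_, ?_⟩
  · rw [hdom, h₂, P.principal.invariant p h hht.symm]
  · rw [← P.left.anchor_act _ _ hdom, h₁]

/-- At most one map between the orbit spaces is induced by a bibundle. -/
theorem DescendsTo.unique {P : Bibundle.{u, v, u', v', w} G H}
    {φ φ' : G.OrbitSpace → H.OrbitSpace} (h : P.DescendsTo φ) (h' : P.DescendsTo φ') :
    φ = φ' := by
  funext y
  obtain ⟨x, rfl⟩ := Quotient.exists_rep y
  obtain ⟨p, rfl⟩ := P.principal.surjective x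
  exact (h p).trans (h' p).symm

/-- Isomorphic bibundles induce the same maps between the orbit spaces. -/
theorem Iso.descendsTo {P : Bibundle.{u, v, u', v', w} G H} {Q : Bibundle.{u, v, u', v', w'} G H}
    (α : P.Iso Q) {φ : G.OrbitSpace → H.OrbitSpace} (h : Q.DescendsTo φ) : P.DescendsTo φ := by
  intro p
  rw [← α.left_anchor, ← α.right_anchor]
  exact h _

/-- A bibundle induces a smooth map between the orbit spaces. -/
theorem exists_descendsTo : ∃ φ : G.OrbitSpace → H.OrbitSpace,
    IsSmoothMap G.orbitStructure H.orbitStructure φ ∧ P.DescendsTo φ :=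
  exists_isSmoothMap_quotient G.orbitRel H.orbitRel P.principal.surjective P.principal.submersion
    P.right.smooth_anchor fun _ _ => P.orbitRel_right_anchor

/-- A smooth map induced by a Morita equivalence is a diffeomorphism of orbit spaces. -/
theorem IsInvertible.isDiffeomorphism {P : Bibundle.{u, v, u', v', w} G H} (hP : P.IsInvertible)
    {φ : G.OrbitSpace → H.OrbitSpace} (hφ : IsSmoothMap G.orbitStructure H.orbitStructure φ)
    (h : P.DescendsTo φ) : IsDiffeomorphism G.orbitStructure H.orbitStructure φ := by
  obtain ⟨ψ, hψ, h'⟩ := exists_isSmoothMap_quotient H.orbitRel G.orbitRel hP.surjective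
    hP.submersion P.left.smooth_anchor fun _ _ => hP.orbitRel_left_anchor
  -- Both composites are checked on classes of anchors of points of `P`, where `φ` and `ψ` just swap
  -- the two anchors.
  refine ⟨⟨φ, ψ, fun y => ?_, fun y => ?_⟩, rfl, hφ, hψ⟩
  · obtain ⟨x, rfl⟩ := Quotient.exists_rep y
    obtain ⟨p, rfl⟩ := P.principal.surjective x
    exact (congrArg ψ (h p)).trans (h' p)
  · obtain ⟨x, rfl⟩ := Quotient.exists_rep y
    obtain ⟨p, rfl⟩ := hP.surjective x
    exact (congrArg φ (h' p)).trans (h p)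

end Bibundle

end OrbitMap

theorem lemmal (G : OrbitMap.LieGroupoid.{u, v}) (H : OrbitMap.LieGroupoid.{u', v'})
    (hG : G.IsEffectiveProperEtale) (hH : H.IsEffectiveProperEtale)
    (P : OrbitMap.Bibundle.{u, v, u', v', w} G H) :
    ∃ Pbar : G.OrbitSpace → H.OrbitSpace,
      (OrbitMap.IsSmoothMap G.orbitStructure H.orbitStructure Pbar ∧ P.DescendsTo Pbar ∧
        ∀ φ : G.OrbitSpace → H.OrbitSpace, P.DescendsTo φ → φ = Pbar) ∧
      (P.IsInvertible →
        OrbitMap.IsDiffeomorphism G.orbitStructure H.orbitStructure Pbar) ∧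
      ∀ Q : OrbitMap.Bibundle.{u, v, u', v', w'} G H, Nonempty (P.Iso Q) →
        ∀ Qbar : G.OrbitSpace → H.OrbitSpace, Q.DescendsTo Qbar → Qbar = Pbar := by
  obtain ⟨Pbar, hsmooth, hdesc⟩ := P.exists_descendsTo
  exact ⟨Pbar, ⟨hsmooth, hdesc, fun φ hφ => hφ.unique hdesc⟩,
    fun hP => hP.isDiffeomorphism hsmooth hdesc,
    fun Q ⟨α⟩ Qbar hQ => (α.descendsTo hQ).unique hdesc⟩
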